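/- **Setting.** Let $1\le K\le N$. On a probability space let $K$ users have independent channel vectors in $\mathbb C^N$, each with law $\mathcal{CN}(0,2\mathbf I_N)$ (all real and imaginary parts of the entries are independent standard normal). Relabel the users, for every realization, so that $\|\mathbf h_1\|\ge\dots\ge\|\mathbf h_K\|$; the $k$-th user is the one with the $k$-th largest norm. For a finite list of vectors $\mathbf A$ let $\Pi_{\mathbf A}$ be the orthogonal projection onto its span, $\Pi^\perp_{\mathbf A}=\mathbf I-\Pi_{\mathbf A}$, and $\phi(\mathbf A,\mathbf b)=\|\Pi_{\mathbf A}\mathbf b\|^2/\|\mathbf b\|^2$; let $\theta(\mathbf A,\mathbf B)$ be the maximum of all $\phi(\mathbf A,\mathbf b_i)$ and all $\phi(\mathbf B,\mathbf a_j)$ (where $\mathbf a_j,\mathbf b_i$ are the members of $\mathbf A,\mathbf B$), and $\theta=0$ if $\mathbf A$ or $\mathbf B$ is empty. **User grouping.** Fix $\theta^{th}\in(0,1)$. Start with $\mathbf f_u=\mathbf h_u$, candidate set $\mathcal K=\{1,\dots,K\}$ and $n=1$; write $\mathbf F_S=[\mathbf f_u]_{u\in S}$. While $n\le K$: if there is $S\subseteq\mathcal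 K$ with $|S|=n$ and $\theta(\mathbf F_{\mathcal K\setminus S},\mathbf F_S)\le\theta^{th}$, choose one such $S$ (in any way), make it the next group, replace $\mathcal K$ by $\mathcal K\setminus S$, and replace $\mathbf f_u$ by $\Pi^\perp_{\mathbf F_S}\mathbf f_u$ for the remaining users $u$; otherwise increase $n$ by one. Any users left when the loop ends form one last group. This gives a partition of the users into groups $\mathcal G$. **Transmission.** The noise variance is one and the total power is $P_t$. Inter-group zero forcing gives user $u\in\mathcal G$ the effective channel $\mathbf g_u=\Pi^\perp_{[\mathbf h_v:\,v\notin\mathcal G]}\mathbf h_u$. The group $\mathcal G$ gets the power $|\mathcal G|P_t/K$. With $\ell=|\mathcal G|$, number the users of $\mathcal G$ so that $\|\mathbf g_1\|\ge\dots\ge\|\mathbf g_\ell\|$. All of them use one common beam vector $\mathbf w$ that maximizes $\min_{i\le\ell}|(\mathbf g_i/\|\mathbf g_i\|)^H\mathbf w|^2$ subject to $\|\mathbf w\|\le1$, user $i$ gets the power $p_i=\delta_i\,\ell P_t/K$, and superposition coding with successive interference cancellation gives user $i$ the rate $$\log_2\Bigl(1+\min_{j\le i}\frac{p_i|\mathbf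 g_j^H\mathbf w|^2}{\sum_{m<i}p_m|\mathbf g_j^H\mathbf w|^2+1}\Bigr).$$ **Power split.** Fix a target rate $R^{th}>0$. For every nonempty set $\mathcal G$ of users, fix ratios $(\delta_1,\dots,\delta_\ell)$, $\ell=|\mathcal G|$, not depending on $P_t$ or on the channels otherwise, that are *proper*: $\delta_i>0$, $\sum_{i=1}^{\ell}\delta_i=1$, and $\frac{\delta_i}{2^{R^{th}}-1}-\sum_{m<i}\delta_m>0$ for $2\le i\le\ell$. **Theorem.** (a) Proper ratios exist: for every $C>0$, the ratios $\delta_1=(2^{R^{th}}+C)^{-(\ell-1)}$, $\delta_i=(2^{R^{th}}-1+C)(2^{R^{th}}+C)^{-(\ell-i+1)}$ $(2\le i\le\ell)$ are proper. (b) For every choice of proper ratios, the rate $R_k$ of the $k$-th user satisfies, for every $k=1,\dots,K$, $$D_k:=\lim_{P_t\to\infty}-\frac{\log\Pr\{R_k<R^{th}\}}{\log P_t}=N(K-k+1).$$ -/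

import Mathlib

open MeasureTheory ProbabilityTheory Filter Topology

noncomputable section

namespace MisoBC

/-- Column vectors in `ℂ^N` with the Euclidean norm; `inner ℂ x y` is `xᴴ y`. -/
abbrev Vec (N : ℕ) : Type := EuclideanSpace ℂ (Fin N)

/-! ### Rayleigh fading -/

/-- The law `CN(0, 2)` on `ℂ`: independent standard normal real and imaginary parts. -/
def complexGaussian : Measure ℂ :=
  ((gaussianReal 0 1).prod (gaussianReal 0 1)).map fun p : ℝ × ℝ => (⟨p.1, p.2⟩ : ℂ)

/-- The law `CN(0, 2 I)` on `ℂ^N`: independent `CN(0, 2)` coordinates. -/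
def rayleigh (N : ℕ) : Measure (Vec N) :=
  (Measure.pi fun _ : Fin N => complexGaussian).map (WithLp.toLp 2)

variable {N K : ℕ}

/-! ### Subspace angles

A matrix `F_S` is given by a family of vectors `f` and the set `S` of the indices of its columns. -/

/-- The orthogonal projection `Π_{F_S}` onto the column space of `F_S`. -/
def proj (f : Fin K → Vec N) (S : Finset (Fin K)) : Vec N →L[ℂ] Vec N :=
  (Submodule.span ℂ (f '' (S : Set (Fin K)))).starProjection

/-- The orthogonal projection of `x` onto the orthogonal complement of the column space of `F_S`. -/
def projPerp (f : Fin K → Vec N) (S : Finset (Fin K)) (x : Vec N) : Vec N := x - proj f S x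

/-- `φ(F_S, b) = ‖Π_{F_S} b‖² / ‖b‖²`. -/
def phi (f : Fin K → Vec N) (S : Finset (Fin K)) (b : Vec N) : ℝ :=
  ‖proj f S b‖ ^ 2 / ‖b‖ ^ 2

open Classical in
/-- `θ(F_A, F_B)`: the largest of the numbers `φ(F_A, f_b)`, `b ∈ B`, and `φ(F_B, f_a)`, `a ∈ A`
(a finite set, so the supremum is a maximum), and `0` if one of the two matrices is empty. -/
def theta (f : Fin K → Vec N) (A B : Finset (Fin K)) : ℝ :=
  if A.Nonempty ∧ B.Nonempty then
    sSup ((fun b => phi f A (f b)) '' (B : Set (Fin K)) ∪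
      (fun a => phi f B (f a)) '' (A : Set (Fin K)))
  else 0

/-! ### User grouping -/

/-- `GroupingRun θth n cand f Gs`: the loop of the grouping algorithm, entered with group size `n`,
candidate set `cand` and current vectors `f`, can produce the further groups `Gs`, in this order.
The choice among several suitable groups is left open. -/
inductive GroupingRun (θth : ℝ) :
    ℕ → Finset (Fin K) → (Fin K → Vec N) → List (Finset (Fin K)) → Prop
  /-- The loop has ended and every user has been assigned. -/
  | done (n : ℕ) (f : Fin K → Vec N) : K < n → GroupingRun θth n ∅ f []
  /-- The loop has ended and some users are left: they form one last group. -/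
  | leftover (n : ℕ) (cand : Finset (Fin K)) (f : Fin K → Vec N) :
      K < n → cand.Nonempty → GroupingRun θth n cand f [cand]
  /-- A suitable group `S` of size `n` is found. It is recorded and removed, and the vectors of the
  remaining users are projected onto the orthogonal complement of its column space. (The vectors of
  the other users are not used any more.) -/
  | pick (n : ℕ) (cand S : Finset (Fin K)) (f : Fin K → Vec N) (Gs : List (Finset (Fin K))) :
      n ≤ K → S ⊆ cand → S.card = n → theta f (cand \ S) S ≤ θth →
      GroupingRun θth n (cand \ S) (fun u => projPerp f S (f u)) Gs →
      GroupingRun θth n cand f (S :: Gs)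
  /-- There is no suitable group of size `n`: the size is increased by one. -/
  | next (n : ℕ) (cand : Finset (Fin K)) (f : Fin K → Vec N) (Gs : List (Finset (Fin K))) :
      n ≤ K → (∀ S, S ⊆ cand → S.card = n → ¬ theta f (cand \ S) S ≤ θth) →
      GroupingRun θth (n + 1) cand f Gs → GroupingRun θth n cand f Gs

/-- `Gs` is a list of groups that the grouping algorithm can return for the channels `H`. -/
def IsGrouping (θth : ℝ) (H : Fin K → Vec N) (Gs : List (Finset (Fin K))) : Prop :=
  GroupingRun θth 1 Finset.univ H Gs

/-- The group of user `u`. -/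
def groupOf (Gs : List (Finset (Fin K))) (u : Fin K) : Finset (Fin K) :=
  (Gs.find? fun G => decide (u ∈ G)).getD ∅

/-- The effective channels of the users of a group `G` after zero forcing across the groups: `h_u`
is projected onto the orthogonal complement of the span of the channels of all users outside `G`. -/
def effChannel (H : Fin K → Vec N) (G : Finset (Fin K)) (u : Fin K) : Vec N :=
  projPerp H Gᶜ (H u)

/-! ### Superposition coding and successive interference cancellation in one group -/

/-- In the order of decreasing effective channel norm, `v` comes strictly before `u`
(equal norms: the smaller label comes first). -/
def Before (g : Fin K → Vec N) (v u : Fin K) : Prop :=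
  ‖g u‖ < ‖g v‖ ∨ (‖g v‖ = ‖g u‖ ∧ v < u)

open Classical in
/-- The users of the group strictly before `u`; their signals are not cancelled when the message
for `u` is decoded. -/
def interferers (g : Fin K → Vec N) (G : Finset (Fin K)) (u : Fin K) : Finset (Fin K) :=
  G.filter fun v => Before g v u

/-- The position `1, …, |G|` of user `u` in its group. -/
def position (g : Fin K → Vec N) (G : Finset (Fin K)) (u : Fin K) : ℕ :=
  (interferers g G u).card + 1

/-- The SINR when user `v` decodes the message for user `u` (unit noise variance); `p` and `w` are
the powers and the beam vectors of the users. -/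
def sinr (g : Fin K → Vec N) (G : Finset (Fin K)) (p : Fin K → ℝ) (w : Fin K → Vec N)
    (v u : Fin K) : ℝ :=
  p u * ‖inner ℂ (g v) (w u)‖ ^ 2 /
    (∑ m ∈ interferers g G u, p m * ‖inner ℂ (g v) (w m)‖ ^ 2 + 1)

/-- The rate of user `u`: the message for `u` is decoded by `u` and by all users before `u`.
For the first user this is `log₂ (1 + p |gᴴ w|²)`. -/
def sicRate (g : Fin K → Vec N) (G : Finset (Fin K)) (p : Fin K → ℝ) (w : Fin K → Vec N)
    (u : Fin K) : ℝ :=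
  Real.logb 2 (1 + ⨅ v : {v // v ∈ insert u (interferers g G u)}, sinr g G p w v u)

/-! ### Beam vector and power split of a group -/

/-- The smallest of the numbers `|(g_u / ‖g_u‖)ᴴ w|²`, `u ∈ G`. -/
def minGain (g : Fin K → Vec N) (G : Finset (Fin K)) (w : Vec N) : ℝ :=
  ⨅ u : {u // u ∈ G}, ‖inner ℂ (g u) w‖ ^ 2 / ‖g u‖ ^ 2

/-- `w` solves the max-min problem "maximize `minGain g G w` subject to `‖w‖² ≤ 1`". For a group
`{u}` these are the maximal-ratio beam vectors `g_u / ‖g_u‖`, up to a phase. -/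
def IsMaxMinBeam (g : Fin K → Vec N) (G : Finset (Fin K)) (w : Vec N) : Prop :=
  ‖w‖ ^ 2 ≤ 1 ∧ ∀ w' : Vec N, ‖w'‖ ^ 2 ≤ 1 → minGain g G w' ≤ minGain g G w

/-- A power split gives to each group `G` the ratios `δ G 1, …, δ G |G|` of the group power that
are used for the users in positions `1, …, |G|`. It is proper for the target rate `R` if the ratios
are positive, add up to one, and satisfy `δ_i / (2 ^ R - 1) - ∑_{m < i} δ_m > 0` for `i ≥ 2`. -/
def IsProperSplit (R : ℝ) (δ : Finset (Fin K) → ℕ → ℝ) : Prop :=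
  ∀ G : Finset (Fin K), G.Nonempty →
    (∀ i ∈ Finset.Icc 1 G.card, 0 < δ G i) ∧
    ∑ i ∈ Finset.Icc 1 G.card, δ G i = 1 ∧
    ∀ i ∈ Finset.Icc 2 G.card, 0 < δ G i / (2 ^ R - 1) - ∑ m ∈ Finset.Ico 1 i, δ G m

/-- The explicit split with parameter `C > 0`: with `a = 2 ^ R + C` and `ℓ = |G|`,
`δ_1 = 1 / a ^ (ℓ - 1)` and `δ_i = (a - 1) / a ^ (ℓ - i + 1)` for `i = 2, …, ℓ`. -/
def explicitSplit (R C : ℝ) (G : Finset (Fin K)) (i : ℕ) : ℝ :=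
  if i = 1 then 1 / (2 ^ R + C) ^ (G.card - 1)
  else (2 ^ R - 1 + C) / (2 ^ R + C) ^ (G.card - i + 1)

/-! ### The mixture scheme -/

/-- The rate of user `u` under the mixture scheme with channels `H`, groups `Gs`, power split `δ`,
common beam vector `w G` in each group `G`, and total power `Pt`, of which `|G| Pt / K` goes to the
group `G`. -/
def mixtureRate (H : Fin K → Vec N) (Gs : List (Finset (Fin K))) (δ : Finset (Fin K) → ℕ → ℝ)
    (w : Finset (Fin K) → Vec N) (Pt : ℝ) (u : Fin K) : ℝ :=
  let G := groupOf Gs u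
  let g := effChannel H G
  sicRate g G (fun v => δ G (position g G v) * (G.card * Pt / K)) (fun _ => w G) u

end MisoBC

end

/-!
The outage event of the user with the `k`-th largest channel norm is, up to a null set and up to
constants, the event `‖h_k‖² < const / Pt`.

* If `‖h_k‖² < (2 ^ R - 1) / Pt`, the user cannot decode its own message even without interference
  (`MisoBC.mixtureRate_lt`), because zero forcing and the beam vector only lose gain.
* Conversely, the scheme loses at most a constant factor. The effective channel satisfies
  `‖g_u‖² ≥ (1 - θ) ^ K ‖h_u‖²` (`MisoBC.IsGrouping.le_norm_sq_effChannel`): every group found by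
  the algorithm makes an angle bounded away from zero with each remaining vector, and vice versa, and
  projecting successively is the same as projecting once (`MisoBC.projPerp_union`). The optimal beam
  vector has a gain bounded below on all directions of the group, whatever they are
  (`MisoBC.exists_norm_inner_ge`). All users that decode a given message have gains at least that of
  its owner, and a proper power split leaves a fixed share of the power over the interference. So
  `‖h_k‖² ≥ A / Pt` and nonzero channels imply that the target is met
  (`MisoBC.exists_le_mixtureRate`).

The ball of radius `r` has Rayleigh measure of order `r ^ (2 N)`
(`MisoBC.rayleigh_ball_le`, `MisoBC.exists_le_rayleigh_ball`), and the `k`-th largest norm is below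
`r` exactly if some `K - k + 1` of the independent channels lie in that ball. Hence the outage
probability is of order `Pt ^ (-N (K - k + 1))`. The outage event need not be measurable, since the
groups and beam vectors are arbitrary; it is only compared with measurable events.
-/

namespace MisoBC

variable {N K : ℕ}

/-! ### The explicit power split -/

/-- The partial sums telescope, since `1 / a ^ m + (a - 1) / a ^ m = 1 / a ^ (m - 1)`. -/
theorem sum_explicitSplit {R C : ℝ} (hC : 0 < C) (G : Finset (Fin K)) {j : ℕ} (hj : 1 ≤ j)
    (hjG : j ≤ G.card) :
    ∑ m ∈ Finset.Ico 1 (j + 1), explicitSplit R C G m = 1 / (2 ^ R + C) ^ (G.card - j) := by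
  have ha : (0 : ℝ) < 2 ^ R + C := by positivity
  induction j, hj using Nat.le_induction with
  | base => simp [explicitSplit]
  | succ j hj ih =>
    rw [Finset.sum_Ico_succ_top (by omega), ih (by omega), explicitSplit, if_neg (by omega)]
    obtain ⟨d, hd⟩ := Nat.exists_eq_add_of_le hjG
    have h1 : G.card - j = d + 1 := by omega
    have h2 : G.card - (j + 1) = d := by omega
    rw [h1, h2]
    field_simp
    ring

theorem isProperSplit_explicitSplit {R C : ℝ} (hR : 0 < R) (hC : 0 < C) :
    IsProperSplit (K := K) R (explicitSplit R C) := by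
  have h1 : (0 : ℝ) < 2 ^ R - 1 := sub_pos.2 (Real.one_lt_rpow (by norm_num) hR)
  have ha : (0 : ℝ) < 2 ^ R + C := by positivity
  intro G hG
  have hcard : 1 ≤ G.card := hG.card_pos
  refine ⟨fun i _ => ?_, ?_, fun i hi => ?_⟩
  · unfold explicitSplit
    split_ifs <;> positivity
  · have := sum_explicitSplit (R := R) hC G hcard le_rfl
    simpa [Finset.Ico_add_one_right_eq_Icc] using this
  · rw [Finset.mem_Icc] at hi
    obtain ⟨j, rfl⟩ : ∃ j, i = j + 1 := ⟨i - 1, by omega⟩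
    have h2 : G.card - (j + 1) + 1 = G.card - j := by omega
    rw [sum_explicitSplit hC G (by omega) (by omega), explicitSplit, if_neg (by omega), h2,
      show (2 ^ R - 1 + C) / (2 ^ R + C) ^ (G.card - j) / (2 ^ R - 1) -
        1 / (2 ^ R + C) ^ (G.card - j) = C / (2 ^ R + C) ^ (G.card - j) / (2 ^ R - 1) by
          field_simp; ring]
    positivity

/-- A proper split leaves a uniform margin of power over the scaled interference, in all groups and
at all positions. -/
theorem IsProperSplit.exists_margin {R : ℝ} (hR : 0 < R) {δ : Finset (Fin K) → ℕ → ℝ}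
    (hδ : IsProperSplit R δ) :
    ∃ η > 0, ∀ G : Finset (Fin K), ∀ i ∈ Finset.Icc 1 G.card,
      η ≤ δ G i - (2 ^ R - 1) * ∑ m ∈ Finset.Ico 1 i, δ G m := by
  have h1 : (0 : ℝ) < 2 ^ R - 1 := sub_pos.2 (Real.one_lt_rpow (by norm_num) hR)
  have hpos : ∀ G : Finset (Fin K), ∀ i ∈ Finset.Icc 1 G.card,
      0 < δ G i - (2 ^ R - 1) * ∑ m ∈ Finset.Ico 1 i, δ G m := by
    intro G i hi
    have hi' := Finset.mem_Icc.1 hi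
    obtain ⟨hδ0, -, hδ2⟩ := hδ G (Finset.card_pos.1 (by omega))
    rcases hi'.1.eq_or_lt with rfl | h2
    · simpa using hδ0 1 hi
    · have := mul_pos h1 (hδ2 i (Finset.mem_Icc.2 ⟨h2, hi'.2⟩))
      rwa [mul_sub, mul_div_cancel₀ _ h1.ne'] at this
  have hev : ∀ᶠ η in 𝓝[>] (0 : ℝ), ∀ G : Finset (Fin K), ∀ i ∈ Finset.Icc 1 G.card,
      η ≤ δ G i - (2 ^ R - 1) * ∑ m ∈ Finset.Ico 1 i, δ G m := by
    refine eventually_all.2 fun G => (eventually_all_finset _).2 fun i hi => ?_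
    exact (eventually_le_nhds (hpos G i hi)).filter_mono nhdsWithin_le_nhds
  obtain ⟨η, hη, hη0⟩ := (hev.and self_mem_nhdsWithin).exists
  exact ⟨η, hη0, hη⟩

/-! ### Channel norms after the grouping -/

theorem proj_mem (f : Fin K → Vec N) (S : Finset (Fin K)) (x : Vec N) :
    proj f S x ∈ Submodule.span ℂ (f '' (S : Set (Fin K))) :=
  Submodule.starProjection_apply_mem _ _

theorem projPerp_mem (f : Fin K → Vec N) (S : Finset (Fin K)) (x : Vec N) :
    projPerp f S x ∈ (Submodule.span ℂ (f '' (S : Set (Fin K))))ᗮ :=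
  Submodule.sub_starProjection_mem_orthogonal _

theorem projPerp_empty (f : Fin K → Vec N) (x : Vec N) : projPerp f ∅ x = x := by
  simp [projPerp, proj]

theorem norm_sq_projPerp (f : Fin K → Vec N) (S : Finset (Fin K)) (x : Vec N) :
    ‖projPerp f S x‖ ^ 2 = ‖x‖ ^ 2 - ‖proj f S x‖ ^ 2 := by
  have h := Submodule.norm_sq_eq_add_norm_sq_starProjection x
    (Submodule.span ℂ (f '' (S : Set (Fin K))))
  rw [Submodule.starProjection_orthogonal_val] at h
  simp only [projPerp, proj]
  linarith

theorem norm_projPerp_le (f : Fin K → Vec N) (S : Finset (Fin K)) (x : Vec N) :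
    ‖projPerp f S x‖ ≤ ‖x‖ := by
  rw [← sq_le_sq₀ (norm_nonneg _) (norm_nonneg _), norm_sq_projPerp]
  linarith [sq_nonneg ‖proj f S x‖]

/-- Removing the columns in `S` and then the projected columns in `T` removes the columns in
`S ∪ T`. -/
theorem projPerp_union (f : Fin K → Vec N) (S T : Finset (Fin K)) (x : Vec N) :
    projPerp f (S ∪ T) x = projPerp (fun u => projPerp f S (f u)) T (projPerp f S x) := by
  set f' : Fin K → Vec N := fun u => projPerp f S (f u) with hf'
  set U := Submodule.span ℂ (f '' ((S ∪ T : Finset (Fin K)) : Set (Fin K))) with hU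
  have hSU : Submodule.span ℂ (f '' (S : Set (Fin K))) ≤ U :=
    Submodule.span_mono (Set.image_mono (by simp))
  have hT'U : Submodule.span ℂ (f' '' (T : Set (Fin K))) ≤ U := by
    rw [Submodule.span_le]
    rintro _ ⟨t, ht, rfl⟩
    exact U.sub_mem (Submodule.subset_span ⟨t, by simp [Finset.mem_coe.1 ht], rfl⟩)
      (hSU (proj_mem f S (f t)))
  have hT'S : Submodule.span ℂ (f' '' (T : Set (Fin K))) ≤
      (Submodule.span ℂ (f '' (S : Set (Fin K))))ᗮ := by
    rw [Submodule.span_le]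
    rintro _ ⟨t, -, rfl⟩
    exact projPerp_mem f S (f t)
  set y := projPerp f' T (projPerp f S x) with hy
  have hyS : y ∈ (Submodule.span ℂ (f '' (S : Set (Fin K))))ᗮ :=
    Submodule.sub_mem _ (projPerp_mem f S x) (hT'S (proj_mem f' T _))
  have hyT : y ∈ (Submodule.span ℂ (f' '' (T : Set (Fin K))))ᗮ := projPerp_mem f' T _
  have hyU : y ∈ Uᗮ := by
    rw [Submodule.mem_orthogonal] at hyS hyT ⊢
    have hUle : U ≤ LinearMap.ker (innerₛₗ ℂ y) := by
      rw [hU, Submodule.span_le]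
      rintro _ ⟨t, ht, rfl⟩
      rw [SetLike.mem_coe, LinearMap.mem_ker, innerₛₗ_apply_apply, inner_eq_zero_symm]
      rcases Finset.mem_union.1 (Finset.mem_coe.1 ht) with ht | ht
      · exact hyS _ (Submodule.subset_span ⟨t, ht, rfl⟩)
      · have h1 : f t = f' t + proj f S (f t) := by simp [hf', projPerp]
        rw [h1, inner_add_left, hyT _ (Submodule.subset_span ⟨t, ht, rfl⟩),
          hyS _ (proj_mem f S _), add_zero]
    intro u hu
    have := hUle hu
    rwa [LinearMap.mem_ker, innerₛₗ_apply_apply, inner_eq_zero_symm] at this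
  have hxy : x - y ∈ U := by
    have h1 : x - y = proj f S x + proj f' T (projPerp f S x) := by
      simp only [hy, projPerp]; abel
    rw [h1]
    exact U.add_mem (hSU (proj_mem f S x)) (hT'U (proj_mem f' T _))
  have h2 : U.starProjection x = x - y :=
    Submodule.eq_starProjection_of_mem_orthogonal hxy (by simpa using hyU)
  have h3 : projPerp f (S ∪ T) x = x - U.starProjection x := rfl
  rw [h3, h2, sub_sub_cancel]

theorem le_norm_sq_projPerp_of_phi_le {f : Fin K → Vec N} {S : Finset (Fin K)} {x : Vec N} {θ : ℝ}
    (h : phi f S x ≤ θ) : (1 - θ) * ‖x‖ ^ 2 ≤ ‖projPerp f S x‖ ^ 2 := by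
  rcases eq_or_ne x 0 with rfl | hx
  · simp
  · have hx' : 0 < ‖x‖ ^ 2 := by positivity
    rw [phi, div_le_iff₀ hx'] at h
    rw [norm_sq_projPerp]
    linarith

theorem theta_comm (f : Fin K → Vec N) (A B : Finset (Fin K)) : theta f A B = theta f B A := by
  simp only [theta, and_comm, Set.union_comm]

/-- If `θ(F_A, F_B) ≤ θ`, projecting out `F_A` costs the columns of `F_B` at most the factor
`1 - θ`; this includes the case of an empty `A`. -/
theorem le_norm_sq_projPerp_of_theta_le {f : Fin K → Vec N} {A B : Finset (Fin K)} {θ : ℝ}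
    (hθ : 0 ≤ θ) (h : theta f A B ≤ θ) {b : Fin K} (hb : b ∈ B) :
    (1 - θ) * ‖f b‖ ^ 2 ≤ ‖projPerp f A (f b)‖ ^ 2 := by
  rcases A.eq_empty_or_nonempty with rfl | hA
  · rw [projPerp_empty]
    nlinarith [sq_nonneg ‖f b‖]
  · refine le_norm_sq_projPerp_of_phi_le (le_trans ?_ h)
    rw [theta, if_pos ⟨hA, b, hb⟩]
    exact le_csSup (((B.finite_toSet.image _).union (A.finite_toSet.image _)).bddAbove)
      (Or.inl ⟨b, hb, rfl⟩)

theorem GroupingRun.exists_mem {θ : ℝ} {n : ℕ} {cand : Finset (Fin K)} {f : Fin K → Vec N}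
    {Gs : List (Finset (Fin K))} (h : GroupingRun θ n cand f Gs) {u : Fin K} (hu : u ∈ cand) :
    ∃ G ∈ Gs, u ∈ G := by
  induction h with
  | done n f hn => simp at hu
  | leftover n cand f hn hc => exact ⟨cand, by simp, hu⟩
  | pick n cand S f Gs hn hS hcard hθ hrun ih =>
    by_cases huS : u ∈ S
    · exact ⟨S, by simp, huS⟩
    · obtain ⟨G, hG, huG⟩ := ih (Finset.mem_sdiff.2 ⟨hu, huS⟩)
      exact ⟨G, by simp [hG], huG⟩
  | next n cand f Gs hn hno hrun ih => exact ih hu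

theorem GroupingRun.subset {θ : ℝ} {n : ℕ} {cand : Finset (Fin K)} {f : Fin K → Vec N}
    {Gs : List (Finset (Fin K))} (h : GroupingRun θ n cand f Gs) {G : Finset (Fin K)}
    (hG : G ∈ Gs) : G ⊆ cand := by
  induction h with
  | done n f hn => simp at hG
  | leftover n cand f hn hc => simp_all
  | pick n cand S f Gs hn hS hcard hθ hrun ih =>
    rcases List.mem_cons.1 hG with rfl | hG
    · exact hS
    · exact (ih hG).trans Finset.sdiff_subset
  | next n cand f Gs hn hno hrun ih => exact ih hG

/-- Each picked group costs a user at most the factor `1 - θ`, whether the user belongs to the group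
or stays a candidate, and every pick removes a candidate. -/
theorem GroupingRun.le_norm_sq {θ : ℝ} (hθ : θ ∈ Set.Ioo (0 : ℝ) 1) {n : ℕ}
    {cand : Finset (Fin K)} {f : Fin K → Vec N} {Gs : List (Finset (Fin K))}
    (h : GroupingRun θ n cand f Gs) (hn1 : 1 ≤ n) {G : Finset (Fin K)} (hG : G ∈ Gs) {u : Fin K}
    (hu : u ∈ G) :
    (1 - θ) ^ cand.card * ‖f u‖ ^ 2 ≤ ‖projPerp f (cand \ G) (f u)‖ ^ 2 := by
  obtain ⟨hθ0, hθ1⟩ := hθ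
  have h0 : 0 ≤ 1 - θ := by linarith
  have h1 : 1 - θ ≤ 1 := by linarith
  induction h with
  | done n f hn => simp at hG
  | leftover n cand f hn hc =>
    obtain rfl : G = cand := by simpa using hG
    rw [Finset.sdiff_self, projPerp_empty]
    exact mul_le_of_le_one_left (sq_nonneg _) (pow_le_one₀ h0 h1)
  | pick n cand S f Gs hn hS hcard htheta hrun ih =>
    rcases List.mem_cons.1 hG with rfl | hG
    · refine le_trans ?_ (le_norm_sq_projPerp_of_theta_le hθ0.le htheta hu)
      have hc : cand.card ≠ 0 := (Finset.card_pos.2 ⟨u, hS hu⟩).ne'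
      exact mul_le_mul_of_nonneg_right (pow_le_of_le_one h0 h1 hc) (sq_nonneg _)
    · have hGsub := hrun.subset hG
      have hstay : (1 - θ) * ‖f u‖ ^ 2 ≤ ‖projPerp f S (f u)‖ ^ 2 :=
        le_norm_sq_projPerp_of_theta_le hθ0.le (theta_comm f _ _ ▸ htheta) (hGsub hu)
      have hunion : cand \ G = S ∪ ((cand \ S) \ G) := by
        ext v
        have hv := @hGsub v
        have hv' := @hS v
        simp only [Finset.mem_sdiff, Finset.mem_union] at hv ⊢
        tauto
      have hlt : (cand \ S).card + 1 ≤ cand.card := by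
        rw [Finset.card_sdiff_of_subset hS]
        have := Finset.card_le_card hS
        omega
      rw [hunion, projPerp_union]
      refine le_trans ?_ (ih hn1 hG)
      calc (1 - θ) ^ cand.card * ‖f u‖ ^ 2
          ≤ (1 - θ) ^ ((cand \ S).card + 1) * ‖f u‖ ^ 2 :=
            mul_le_mul_of_nonneg_right (pow_le_pow_of_le_one h0 h1 hlt) (sq_nonneg _)
        _ = (1 - θ) ^ (cand \ S).card * ((1 - θ) * ‖f u‖ ^ 2) := by ring
        _ ≤ _ := mul_le_mul_of_nonneg_left hstay (pow_nonneg h0 _)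
  | next n cand f Gs hn hno hrun ih => exact ih (by omega) hG

/-- Zero forcing across the groups keeps a fixed fraction of the channel gain. -/
theorem IsGrouping.le_norm_sq_effChannel {θ : ℝ} (hθ : θ ∈ Set.Ioo (0 : ℝ) 1)
    {H : Fin K → Vec N} {Gs : List (Finset (Fin K))} (h : IsGrouping θ H Gs)
    {G : Finset (Fin K)} (hG : G ∈ Gs) {u : Fin K} (hu : u ∈ G) :
    (1 - θ) ^ K * ‖H u‖ ^ 2 ≤ ‖effChannel H G u‖ ^ 2 := by
  have := GroupingRun.le_norm_sq hθ h le_rfl hG hu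
  rwa [Finset.card_univ, Fintype.card_fin, ← Finset.compl_eq_univ_sdiff] at this

theorem norm_effChannel_le (H : Fin K → Vec N) (G : Finset (Fin K)) (u : Fin K) :
    ‖effChannel H G u‖ ≤ ‖H u‖ :=
  norm_projPerp_le _ _ _

theorem IsGrouping.groupOf_mem {θ : ℝ} {H : Fin K → Vec N} {Gs : List (Finset (Fin K))}
    (h : IsGrouping θ H Gs) (u : Fin K) : groupOf Gs u ∈ Gs ∧ u ∈ groupOf Gs u := by
  obtain ⟨G, hG, hu⟩ := GroupingRun.exists_mem h (Finset.mem_univ u)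
  obtain ⟨G', hG'⟩ : ∃ G', Gs.find? (fun G => decide (u ∈ G)) = some G' := by
    rw [← Option.isSome_iff_exists, List.find?_isSome]
    exact ⟨G, hG, by simpa using hu⟩
  rw [groupOf, hG', Option.getD_some]
  exact ⟨List.mem_of_find?_eq_some hG', by simpa using List.find?_some hG'⟩

/-! ### The max-min beam vector -/

/-- Some beam vector has a uniformly bounded below gain on finitely many directions: a direction is
added by halving the previous beam vector and adding a small multiple of the new direction, with the
phase that makes the two gains add up. -/
theorem exists_norm_inner_ge {ι : Type*} (s : Finset ι) (e : ι → Vec N)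
    (he : ∀ i ∈ s, ‖e i‖ = 1) :
    ∃ w : Vec N, ‖w‖ ≤ 1 ∧ ∀ i ∈ s, (1 / 4 : ℝ) ^ s.card ≤ ‖inner ℂ (e i) w‖ := by
  classical
  induction s using Finset.induction_on with
  | empty => exact ⟨0, by simp, by simp⟩
  | insert a s ha ih =>
    obtain ⟨w, hw, hws⟩ := ih fun i hi => he i (Finset.mem_insert_of_mem hi)
    have hea : ‖e a‖ = 1 := he a (Finset.mem_insert_self a s)
    set z : ℂ := inner ℂ (e a) w
    set c : ℂ := Complex.exp (z.arg * Complex.I)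
    have hc : ‖c‖ = 1 := Complex.norm_exp_ofReal_mul_I _
    have hz : (‖z‖ : ℂ) * c = z := Complex.norm_mul_exp_arg_mul_I z
    rw [Finset.card_insert_of_notMem ha]
    set t : ℝ := (1 / 4) ^ (s.card + 1) with ht
    have ht0 : 0 ≤ t := by positivity
    have ht4 : t ≤ 1 / 4 := by
      rw [ht, pow_succ]
      exact mul_le_of_le_one_left (by norm_num) (pow_le_one₀ (by norm_num) (by norm_num))
    have hct : ‖(t : ℂ) * c‖ = t := by
      rw [norm_mul, hc, mul_one, Complex.norm_real, Real.norm_of_nonneg ht0]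
    refine ⟨(1 / 2 : ℂ) • w + ((t : ℂ) * c) • e a, ?_, fun i hi => ?_⟩
    · calc ‖(1 / 2 : ℂ) • w + ((t : ℂ) * c) • e a‖
          ≤ ‖(1 / 2 : ℂ) • w‖ + ‖((t : ℂ) * c) • e a‖ := norm_add_le _ _
        _ = 1 / 2 * ‖w‖ + t := by rw [norm_smul, norm_smul, hct, hea]; norm_num
        _ ≤ 1 := by linarith
    · rw [inner_add_right, inner_smul_right, inner_smul_right]
      rcases Finset.mem_insert.1 hi with rfl | hi
      · have h1 : (1 / 2 : ℂ) * z + (t : ℂ) * c * inner ℂ (e i) (e i) =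
            ((‖z‖ / 2 + t : ℝ) : ℂ) * c := by
          rw [inner_self_eq_norm_sq_to_K, hea]
          nth_rewrite 1 [← hz]
          push_cast
          ring
        rw [h1, norm_mul, hc, mul_one, Complex.norm_real, Real.norm_of_nonneg (by positivity)]
        linarith [norm_nonneg z]
      · have h1 : ‖(1 / 2 : ℂ) * inner ℂ (e i) w‖ = 1 / 2 * ‖inner ℂ (e i) w‖ := by
          rw [norm_mul]; norm_num
        have h2 : ‖(t : ℂ) * c * inner ℂ (e i) (e a)‖ ≤ t := by
          rw [norm_mul, hct]
          have := norm_inner_le_norm (𝕜 := ℂ) (e i) (e a)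
          rw [hea, he i (Finset.mem_insert_of_mem hi), mul_one] at this
          exact mul_le_of_le_one_right ht0 this
        have h3 := norm_sub_le_norm_add ((1 / 2 : ℂ) * inner ℂ (e i) w)
          ((t : ℂ) * c * inner ℂ (e i) (e a))
        have h4 := hws i hi
        have h5 : t = 1 / 4 * (1 / 4) ^ s.card := by rw [ht, pow_succ']
        linarith

/-- The optimal beam vector is at least as good for every user as the vector of
`exists_norm_inner_ge`. The channels have to be nonzero: a zero channel makes `minGain` vanish. -/
theorem IsMaxMinBeam.le_norm_inner_sq {g : Fin K → Vec N} {G : Finset (Fin K)} {w : Vec N}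
    (hw : IsMaxMinBeam g G w) (hg : ∀ u ∈ G, g u ≠ 0) {u : Fin K} (hu : u ∈ G) :
    (1 / 16 : ℝ) ^ K * ‖g u‖ ^ 2 ≤ ‖inner ℂ (g u) w‖ ^ 2 := by
  have hpos : ∀ v ∈ G, 0 < ‖g v‖ := fun v hv => norm_pos_iff.2 (hg v hv)
  obtain ⟨w', hw', hgain⟩ := exists_norm_inner_ge G (fun v => ((‖g v‖⁻¹ : ℝ) : ℂ) • g v)
    fun v hv => by
      rw [norm_smul, Complex.norm_real, norm_inv, norm_norm, inv_mul_cancel₀ (hpos v hv).ne']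
  have : Nonempty {u // u ∈ G} := ⟨⟨u, hu⟩⟩
  have h1 : (1 / 16 : ℝ) ^ K ≤ minGain g G w' := by
    refine le_ciInf fun ⟨v, hv⟩ => ?_
    have h2 := hgain v hv
    rw [inner_smul_left, norm_mul, Complex.conj_ofReal, Complex.norm_real, norm_inv, norm_norm,
      inv_mul_eq_div] at h2
    rw [← div_pow]
    calc (1 / 16 : ℝ) ^ K ≤ (1 / 16 : ℝ) ^ G.card :=
          pow_le_pow_of_le_one (by norm_num) (by norm_num) (by simpa using G.card_le_univ)
      _ = ((1 / 4 : ℝ) ^ G.card) ^ 2 := by rw [← pow_mul, mul_comm, pow_mul]; norm_num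
      _ ≤ _ := pow_le_pow_left₀ (by positivity) h2 2
  have h2 : minGain g G w ≤ ‖inner ℂ (g u) w‖ ^ 2 / ‖g u‖ ^ 2 :=
    ciInf_le (f := fun u : {u // u ∈ G} => ‖inner ℂ (g u) w‖ ^ 2 / ‖g u‖ ^ 2)
      (Set.finite_range _).bddBelow ⟨u, hu⟩
  have h3 := hw.2 w' (pow_le_one₀ (norm_nonneg _) hw')
  exact (le_div_iff₀ (pow_pos (hpos u hu) 2)).1 ((h1.trans h3).trans h2)

/-! ### Positions in a group -/

theorem mem_interferers {g : Fin K → Vec N} {G : Finset (Fin K)} {u v : Fin K} :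
    v ∈ interferers g G u ↔ v ∈ G ∧ Before g v u := by
  simp [interferers]

theorem Before.trans {g : Fin K → Vec N} {a b c : Fin K} (hab : Before g a b)
    (hbc : Before g b c) : Before g a c := by
  rcases hab with hab | ⟨hab, hab'⟩ <;> rcases hbc with hbc | ⟨hbc, hbc'⟩
  · exact Or.inl (hbc.trans hab)
  · exact Or.inl (hbc ▸ hab)
  · exact Or.inl (hab ▸ hbc)
  · exact Or.inr ⟨hab.trans hbc, hab'.trans hbc'⟩

theorem not_before_self (g : Fin K → Vec N) (a : Fin K) : ¬ Before g a a := by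
  simp [Before]

theorem Before.norm_le {g : Fin K → Vec N} {a b : Fin K} (h : Before g a b) : ‖g b‖ ≤ ‖g a‖ := by
  rcases h with h | h
  · exact h.le
  · exact h.1.ge

theorem before_or_before {g : Fin K → Vec N} {a b : Fin K} (hab : a ≠ b) :
    Before g a b ∨ Before g b a := by
  rcases lt_trichotomy ‖g a‖ ‖g b‖ with h | h | h
  · exact Or.inr (Or.inl h)
  · rcases lt_or_gt_of_ne hab with h' | h'
    · exact Or.inl (Or.inr ⟨h, h'⟩)
    · exact Or.inr (Or.inr ⟨h.symm, h'⟩)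
  · exact Or.inl (Or.inl h)

theorem position_lt_position {g : Fin K → Vec N} {G : Finset (Fin K)} {a b : Fin K} (ha : a ∈ G)
    (hab : Before g a b) : position g G a < position g G b := by
  refine Nat.add_lt_add_right (Finset.card_lt_card (Finset.ssubset_iff_of_subset ?_ |>.2
    ⟨a, mem_interferers.2 ⟨ha, hab⟩, fun h => not_before_self g a (mem_interferers.1 h).2⟩)) 1
  intro v hv
  rw [mem_interferers] at hv ⊢
  exact ⟨hv.1, hv.2.trans hab⟩

theorem position_mem_Icc {g : Fin K → Vec N} {G : Finset (Fin K)} {u : Fin K} (hu : u ∈ G) :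
    position g G u ∈ Finset.Icc 1 G.card := by
  refine Finset.mem_Icc.2 ⟨Nat.succ_pos _, Finset.card_lt_card ?_⟩
  rw [Finset.ssubset_iff_of_subset fun v hv => (mem_interferers.1 hv).1]
  exact ⟨u, hu, fun h => not_before_self g u (mem_interferers.1 h).2⟩

/-- The users before `u` occupy exactly the positions before the position of `u`. -/
theorem sum_interferers_position (g : Fin K → Vec N) (G : Finset (Fin K)) (u : Fin K)
    (F : ℕ → ℝ) :
    ∑ m ∈ interferers g G u, F (position g G m) = ∑ i ∈ Finset.Ico 1 (position g G u), F i := by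
  have hinj : Set.InjOn (position g G) (interferers g G u) := by
    intro a ha b hb hab
    by_contra hne
    rcases before_or_before (g := g) hne with h | h
    · exact (position_lt_position (mem_interferers.1 ha).1 h).ne hab
    · exact (position_lt_position (mem_interferers.1 hb).1 h).ne' hab
  have himage : (interferers g G u).image (position g G) = Finset.Ico 1 (position g G u) := by
    refine Finset.eq_of_subset_of_card_le (Finset.image_subset_iff.2 fun a ha => ?_) ?_
    · have ha' := mem_interferers.1 ha
      exact Finset.mem_Ico.2 ⟨Nat.succ_pos _, position_lt_position ha'.1 ha'.2⟩
    · rw [Finset.card_image_of_injOn hinj, Nat.card_Ico, position, Nat.add_sub_cancel]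
  rw [← himage, Finset.sum_image hinj]

/-! ### Deterministic bounds on the rate -/

/-- The rate reaches the target once the effective gain of the user is a constant multiple of
`1 / Pt`: the users that decode the message have no smaller gain, and a proper split leaves enough
power over the interference. The constant does not depend on the realization. -/
theorem exists_le_mixtureRate {θ R : ℝ} (hθ : θ ∈ Set.Ioo (0 : ℝ) 1) (hR : 0 < R)
    {δ : Finset (Fin K) → ℕ → ℝ} (hδ : IsProperSplit R δ) :
    ∃ A > 0, ∀ (H : Fin K → Vec N) (Gs : List (Finset (Fin K))) (w : Finset (Fin K) → Vec N),
      IsGrouping θ H Gs → (∀ G ∈ Gs, IsMaxMinBeam (effChannel H G) G (w G)) →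
      (∀ u, H u ≠ 0) → ∀ Pt > 0, ∀ u, A / Pt ≤ ‖H u‖ ^ 2 →
        R ≤ mixtureRate H Gs δ w Pt u := by
  obtain ⟨η, hη, hmargin⟩ := hδ.exists_margin hR
  have hT : (0 : ℝ) < 2 ^ R - 1 := sub_pos.2 (Real.one_lt_rpow (by norm_num) hR)
  have hθ1 : 0 < 1 - θ := sub_pos.2 hθ.2
  set c : ℝ := (1 / 16) ^ K * (1 - θ) ^ K with hc
  have hc0 : 0 < c := by positivity
  refine ⟨(2 ^ R - 1) * (K + 1) / (η * c), by positivity, ?_⟩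
  intro H Gs w hGs hw hH Pt hPt u hu
  obtain ⟨hG, huG⟩ := hGs.groupOf_mem u
  simp only [mixtureRate]
  set G := groupOf Gs u
  set g := effChannel H G
  have hKpos : 0 < (K : ℝ) := Nat.cast_pos.2 (Fin.pos u)
  have hℓ : (1 : ℝ) ≤ G.card := Nat.one_le_cast.2 (Finset.card_pos.2 ⟨u, huG⟩)
  set P : ℝ := G.card * Pt / K with hP
  have hP0 : 0 < P := by positivity
  have hgH : ∀ v ∈ G, (1 - θ) ^ K * ‖H v‖ ^ 2 ≤ ‖g v‖ ^ 2 :=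
    fun v hv => hGs.le_norm_sq_effChannel hθ hG hv
  have hg0 : ∀ v ∈ G, g v ≠ 0 := by
    intro v hv h0
    have h1 := hgH v hv
    have h2 : 0 < ‖H v‖ ^ 2 := pow_pos (norm_pos_iff.2 (hH v)) 2
    have h3 : 0 < (1 - θ) ^ K * ‖H v‖ ^ 2 := by positivity
    rw [h0, norm_zero] at h1
    linarith
  -- The gain with which `v` receives is at least the gain of `u`, up to a constant.
  have hgain : ∀ v ∈ insert u (interferers g G u),
      (2 ^ R - 1) ≤ η * P * ‖inner ℂ (g v) (w G)‖ ^ 2 := by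
    intro v hv
    have hvG : v ∈ G ∧ ‖g u‖ ≤ ‖g v‖ := by
      rcases Finset.mem_insert.1 hv with rfl | hv
      · exact ⟨huG, le_rfl⟩
      · exact ⟨(mem_interferers.1 hv).1, (mem_interferers.1 hv).2.norm_le⟩
    have h1 : c * ‖H u‖ ^ 2 ≤ ‖inner ℂ (g v) (w G)‖ ^ 2 := by
      refine le_trans ?_ ((hw G hG).le_norm_inner_sq hg0 hvG.1)
      rw [hc, mul_assoc]
      refine mul_le_mul_of_nonneg_left ((hgH u huG).trans ?_) (by positivity)
      exact pow_le_pow_left₀ (norm_nonneg _) hvG.2 2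
    have h2 : (2 ^ R - 1) * (K + 1) / (η * Pt) ≤ c * ‖H u‖ ^ 2 := by
      refine le_trans (le_of_eq ?_) (mul_le_mul_of_nonneg_left hu hc0.le)
      field_simp
    have h3 : Pt ≤ (K + 1) * P := by
      rw [hP, ← mul_div_assoc, le_div_iff₀ hKpos]
      nlinarith [mul_le_mul_of_nonneg_right hℓ hPt.le, mul_pos hKpos hPt]
    calc (2 : ℝ) ^ R - 1 = (2 ^ R - 1) / (η * Pt) * (η * Pt) := by field_simp
      _ ≤ (2 ^ R - 1) / (η * Pt) * (η * ((K + 1) * P)) := by gcongr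
      _ = η * P * ((2 ^ R - 1) * (K + 1) / (η * Pt)) := by ring
      _ ≤ _ := mul_le_mul_of_nonneg_left (h2.trans h1) (by positivity)
  have hinf : (2 : ℝ) ^ R - 1 ≤ ⨅ v : {v // v ∈ insert u (interferers g G u)},
      sinr g G (fun v => δ G (position g G v) * P) (fun _ => w G) v u := by
    have : Nonempty {v // v ∈ insert u (interferers g G u)} :=
      ⟨⟨u, Finset.mem_insert_self _ _⟩⟩
    refine le_ciInf fun ⟨v, hv⟩ => ?_
    set x : ℝ := ‖inner ℂ (g v) (w G)‖ ^ 2 with hx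
    have hx0 : 0 ≤ x := sq_nonneg _
    have hδ0 := (hδ G ⟨u, huG⟩).1
    have hsum : ∑ m ∈ interferers g G u, δ G (position g G m) * P * x =
        (∑ i ∈ Finset.Ico 1 (position g G u), δ G i) * (P * x) := by
      rw [← sum_interferers_position, Finset.sum_mul]
      exact Finset.sum_congr rfl fun m _ => by ring
    have hS0 : 0 ≤ ∑ i ∈ Finset.Ico 1 (position g G u), δ G i := by
      refine Finset.sum_nonneg fun i hi => (hδ0 i ?_).le
      have h1 := Finset.mem_Ico.1 hi
      have h2 := Finset.mem_Icc.1 (position_mem_Icc (g := g) huG)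
      exact Finset.mem_Icc.2 ⟨h1.1, by omega⟩
    rw [sinr, ← hx, hsum, le_div_iff₀ (by positivity)]
    have h1 := mul_le_mul_of_nonneg_right (hmargin G _ (position_mem_Icc (g := g) huG))
      (mul_nonneg hP0.le hx0)
    have h2 := hgain v hv
    rw [← hx] at h2
    linarith
  rw [sicRate, Real.le_logb_iff_rpow_le (by norm_num) (by linarith)]
  linarith

/-- The user misses the target if its own channel gain is a small multiple of `1 / Pt`. -/
theorem mixtureRate_lt {θ R : ℝ} {δ : Finset (Fin K) → ℕ → ℝ} (hδ : IsProperSplit R δ) {H : Fin K → Vec N}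
    {Gs : List (Finset (Fin K))} {w : Finset (Fin K) → Vec N} (hGs : IsGrouping θ H Gs)
    (hw : ∀ G ∈ Gs, IsMaxMinBeam (effChannel H G) G (w G)) {Pt : ℝ} (hPt : 0 < Pt) {u : Fin K}
    (hu : ‖H u‖ ^ 2 < (2 ^ R - 1) / Pt) : mixtureRate H Gs δ w Pt u < R := by
  obtain ⟨hG, huG⟩ := hGs.groupOf_mem u
  simp only [mixtureRate]
  set G := groupOf Gs u
  set g := effChannel H G
  have hKpos : 0 < (K : ℝ) := Nat.cast_pos.2 (Fin.pos u)
  set P : ℝ := G.card * Pt / K with hP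
  have hP0 : 0 ≤ P := by positivity
  have hPPt : P ≤ Pt := by
    rw [hP, div_le_iff₀ hKpos, mul_comm]
    have : G.card ≤ K := by simpa using G.card_le_univ
    gcongr
  obtain ⟨hδ0, hδ1, -⟩ := hδ G ⟨u, huG⟩
  have hpos := position_mem_Icc (g := g) huG
  have hδle : δ G (position g G u) ≤ 1 :=
    hδ1 ▸ Finset.single_le_sum (fun i hi => (hδ0 i hi).le) hpos
  have hsinr0 : ∀ v, 0 ≤ sinr g G (fun v => δ G (position g G v) * P) (fun _ => w G) v u := by
    intro v
    have h1 := (hδ0 _ hpos).le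
    refine div_nonneg (by positivity) (add_nonneg (Finset.sum_nonneg fun m hm => ?_) zero_le_one)
    have h2 := (hδ0 _ (position_mem_Icc (g := g) (mem_interferers.1 hm).1)).le
    positivity
  have hsinr : sinr g G (fun v => δ G (position g G v) * P) (fun _ => w G) u u < 2 ^ R - 1 := by
    have hgain : ‖inner ℂ (g u) (w G)‖ ^ 2 ≤ ‖H u‖ ^ 2 := by
      refine pow_le_pow_left₀ (norm_nonneg _) ((norm_inner_le_norm _ _).trans ?_) 2
      have h1 : ‖w G‖ ≤ 1 := (sq_le_one_iff₀ (norm_nonneg _)).1 (hw G hG).1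
      exact (mul_le_of_le_one_right (norm_nonneg _) h1).trans (norm_effChannel_le H G u)
    have hδ0' := (hδ0 _ hpos).le
    calc sinr g G (fun v => δ G (position g G v) * P) (fun _ => w G) u u
        ≤ δ G (position g G u) * P * ‖inner ℂ (g u) (w G)‖ ^ 2 := by
          refine div_le_self (by positivity)
            (le_add_of_nonneg_left (Finset.sum_nonneg fun m hm => ?_))
          have h2 := (hδ0 _ (position_mem_Icc (g := g) (mem_interferers.1 hm).1)).le
          positivity
      _ ≤ 1 * Pt * ‖H u‖ ^ 2 := by gcongr
      _ < 2 ^ R - 1 := by rwa [one_mul, mul_comm, ← lt_div_iff₀ hPt]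
  have hle : (⨅ v : {v // v ∈ insert u (interferers g G u)},
      sinr g G (fun v => δ G (position g G v) * P) (fun _ => w G) v u) ≤
      sinr g G (fun v => δ G (position g G v) * P) (fun _ => w G) u u :=
    ciInf_le (f := fun v : {v // v ∈ insert u (interferers g G u)} =>
      sinr g G (fun v => δ G (position g G v) * P) (fun _ => w G) v u)
      (Set.finite_range _).bddBelow ⟨u, Finset.mem_insert_self _ _⟩
  have hge : 0 ≤ ⨅ v : {v // v ∈ insert u (interferers g G u)},
      sinr g G (fun v => δ G (position g G v) * P) (fun _ => w G) v u :=
    Real.iInf_nonneg fun v => hsinr0 v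
  rw [sicRate, Real.logb_lt_iff_lt_rpow (by norm_num) (by linarith)]
  linarith

/-! ### Small balls under the Rayleigh law -/

theorem gaussianReal_Ioo_le (a : ℝ) :
    gaussianReal 0 1 (Set.Ioo (-a) a) ≤ ENNReal.ofReal (2 * a) := by
  rw [gaussianReal_apply _ one_ne_zero]
  calc ∫⁻ x in Set.Ioo (-a) a, gaussianPDF 0 1 x ≤ ∫⁻ _ in Set.Ioo (-a) a, 1 := by
        refine setLIntegral_mono measurable_const fun x _ => ?_
        rw [gaussianPDF_def, ENNReal.ofReal_le_one, gaussianPDFReal]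
        refine mul_le_one₀ (inv_le_one_of_one_le₀ (Real.one_le_sqrt.2 ?_)) (Real.exp_pos _).le
          (Real.exp_le_one_iff.2 (by simp only [NNReal.coe_one]; nlinarith [sq_nonneg (x - 0)]))
        simp only [NNReal.coe_one]
        linarith [Real.pi_gt_three]
    _ = ENNReal.ofReal (2 * a) := by
        rw [setLIntegral_one, Real.volume_Ioo]
        congr 1
        ring

theorem exists_le_gaussianReal_Ioo :
    ∃ c > 0, ∀ a ≤ 1, ENNReal.ofReal (c * a) ≤ gaussianReal 0 1 (Set.Ioo (-a) a) := by
  refine ⟨gaussianPDFReal 0 1 1 * 2,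
    mul_pos (gaussianPDFReal_pos _ _ _ one_ne_zero) two_pos, fun a ha => ?_⟩
  rw [gaussianReal_apply _ one_ne_zero]
  calc ENNReal.ofReal (gaussianPDFReal 0 1 1 * 2 * a)
      = ∫⁻ _ in Set.Ioo (-a) a, gaussianPDF 0 1 1 := by
        rw [setLIntegral_const, Real.volume_Ioo, gaussianPDF_def,
          ← ENNReal.ofReal_mul (gaussianPDFReal_nonneg _ _ _)]
        congr 1
        ring
    _ ≤ ∫⁻ x in Set.Ioo (-a) a, gaussianPDF 0 1 x := by
        refine setLIntegral_mono (measurable_gaussianPDF _ _) fun x hx => ?_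
        simp only [gaussianPDF_def, gaussianPDFReal]
        refine ENNReal.ofReal_le_ofReal
          (mul_le_mul_of_nonneg_left (Real.exp_le_exp.2 ?_) (by positivity))
        have hx2 : x ^ 2 ≤ 1 := by nlinarith [hx.1, hx.2]
        simp only [NNReal.coe_one]
        linarith

theorem measurable_complexMk : Measurable fun p : ℝ × ℝ => (⟨p.1, p.2⟩ : ℂ) :=
  Complex.measurableEquivRealProd.symm.measurable

instance : IsProbabilityMeasure complexGaussian :=
  Measure.isProbabilityMeasure_map measurable_complexMk.aemeasurable

theorem complexGaussian_ball_le (r : ℝ) :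
    complexGaussian (Metric.ball 0 r) ≤ ENNReal.ofReal (2 * r) ^ 2 := by
  rw [complexGaussian, Measure.map_apply measurable_complexMk measurableSet_ball]
  calc _ ≤ ((gaussianReal 0 1).prod (gaussianReal 0 1)) (Set.Ioo (-r) r ×ˢ Set.Ioo (-r) r) := by
        refine measure_mono fun p hp => ?_
        have hp' : ‖(⟨p.1, p.2⟩ : ℂ)‖ < r := by simpa using hp
        exact ⟨abs_lt.1 ((Complex.abs_re_le_norm _).trans_lt hp'),
          abs_lt.1 ((Complex.abs_im_le_norm _).trans_lt hp')⟩
    _ ≤ _ := by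
        rw [Measure.prod_prod, sq]
        exact mul_le_mul' (gaussianReal_Ioo_le r) (gaussianReal_Ioo_le r)

theorem exists_le_complexGaussian_ball :
    ∃ c > 0, ∀ r ≤ 1, ENNReal.ofReal (c * r) ^ 2 ≤ complexGaussian (Metric.ball 0 r) := by
  obtain ⟨c, hc, h⟩ := exists_le_gaussianReal_Ioo
  refine ⟨c / 2, by positivity, fun r hr => ?_⟩
  rw [complexGaussian, Measure.map_apply measurable_complexMk measurableSet_ball]
  calc ENNReal.ofReal (c / 2 * r) ^ 2
      ≤ ((gaussianReal 0 1).prod (gaussianReal 0 1))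
          (Set.Ioo (-(r / 2)) (r / 2) ×ˢ Set.Ioo (-(r / 2)) (r / 2)) := by
        have h1 := h (r / 2) (by linarith)
        rw [show c * (r / 2) = c / 2 * r by ring] at h1
        rw [Measure.prod_prod, sq]
        exact mul_le_mul' h1 h1
    _ ≤ _ := by
        refine measure_mono fun p hp => ?_
        have h1 := abs_lt.2 hp.1
        have h2 := abs_lt.2 hp.2
        have h3 := Complex.norm_le_abs_re_add_abs_im (⟨p.1, p.2⟩ : ℂ)
        rw [Set.mem_preimage, mem_ball_zero_iff]
        simp only at h3
        linarith

theorem rayleigh_apply {s : Set (Vec N)} (hs : MeasurableSet s) :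
    rayleigh N s = Measure.pi (fun _ : Fin N => complexGaussian) (WithLp.toLp 2 ⁻¹' s) :=
  Measure.map_apply (WithLp.measurable_toLp 2 _) hs

theorem rayleigh_ball_le (r : ℝ) :
    rayleigh N (Metric.ball 0 r) ≤ ENNReal.ofReal (2 * r) ^ (2 * N) := by
  rw [rayleigh_apply measurableSet_ball]
  calc _ ≤ Measure.pi (fun _ : Fin N => complexGaussian)
          (Set.univ.pi fun _ => Metric.ball 0 r) := by
        refine measure_mono fun x hx i _ => ?_
        rw [Set.mem_preimage, mem_ball_zero_iff] at hx
        rw [mem_ball_zero_iff]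
        exact (PiLp.norm_apply_le (WithLp.toLp 2 x) i).trans_lt hx
    _ ≤ _ := by
        rw [Measure.pi_pi, Finset.prod_const, Finset.card_univ, Fintype.card_fin, pow_mul]
        exact pow_le_pow_left' (complexGaussian_ball_le r) N

theorem exists_le_rayleigh_ball (N : ℕ) :
    ∃ c > 0, ∀ r, 0 < r → r ≤ 1 →
      ENNReal.ofReal (c * r) ^ (2 * N) ≤ rayleigh N (Metric.ball 0 r) := by
  obtain ⟨c, hc, h⟩ := exists_le_complexGaussian_ball
  refine ⟨c / (N + 1), by positivity, fun r hr hr1 => ?_⟩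
  have hN : (0 : ℝ) < N + 1 := by positivity
  rw [rayleigh_apply measurableSet_ball]
  calc ENNReal.ofReal (c / (N + 1) * r) ^ (2 * N)
      ≤ Measure.pi (fun _ : Fin N => complexGaussian)
          (Set.univ.pi fun _ => Metric.ball 0 (r / (N + 1))) := by
        have h1 := h (r / (N + 1)) ((div_le_one hN).2 (by linarith [N.cast_nonneg (α := ℝ)]))
        rw [show c * (r / (N + 1)) = c / (N + 1) * r by ring] at h1
        rw [Measure.pi_pi, Finset.prod_const, Finset.card_univ, Fintype.card_fin, pow_mul]
        exact pow_le_pow_left' h1 N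
    _ ≤ _ := by
        refine measure_mono fun x hx => ?_
        rw [Set.mem_preimage, mem_ball_zero_iff, ← sq_lt_sq₀ (norm_nonneg _) hr.le,
          EuclideanSpace.norm_sq_eq]
        calc ∑ i, ‖x i‖ ^ 2 ≤ ∑ _i : Fin N, (r / (N + 1)) ^ 2 := by
              refine Finset.sum_le_sum fun i _ => pow_le_pow_left₀ (norm_nonneg _) ?_ 2
              exact (mem_ball_zero_iff.1 (hx i trivial)).le
          _ = N / (N + 1) ^ 2 * r ^ 2 := by
              rw [Finset.sum_const, Finset.card_univ, Fintype.card_fin, nsmul_eq_mul, div_pow]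
              ring
          _ < 1 * r ^ 2 := by
              gcongr
              rw [div_lt_one (by positivity)]
              nlinarith [N.cast_nonneg (α := ℝ)]
          _ = r ^ 2 := one_mul _

/-! ### Order statistics of the channel norms -/

/-- If the `K - k` users in `T` have norm below `r`, then so has the user with 0-based rank `k`, for
one of them has at most that rank. -/
theorem norm_lt_of_card {E : Type*} [NormedAddCommGroup E] {x y : Fin K → E}
    {σ : Equiv.Perm (Fin K)} (hσ : ∀ k, y k = x (σ k)) (hy : Antitone fun k => ‖y k‖) {k : Fin K}
    {r : ℝ} {T : Finset (Fin K)} (hT : T.card = K - k) (hTr : ∀ j ∈ T, ‖x j‖ < r) :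
    ‖y k‖ < r := by
  obtain ⟨j, hj, hjk⟩ : ∃ j ∈ T, σ.symm j ≤ k := by
    by_contra! hcon
    have h1 : T.map σ.symm.toEmbedding ⊆ Finset.Ioi k := by
      intro i hi
      obtain ⟨j, hj, rfl⟩ := Finset.mem_map.1 hi
      exact Finset.mem_Ioi.2 (hcon j hj)
    have h2 := Finset.card_le_card h1
    rw [Finset.card_map, Fin.card_Ioi, hT] at h2
    have := k.isLt
    omega
  calc ‖y k‖ ≤ ‖y (σ.symm j)‖ := hy hjk
    _ = ‖x j‖ := by rw [hσ, Equiv.apply_symm_apply]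
    _ < r := hTr j hj

theorem exists_card_of_norm_lt {E : Type*} [NormedAddCommGroup E] {x y : Fin K → E}
    {σ : Equiv.Perm (Fin K)} (hσ : ∀ k, y k = x (σ k)) (hy : Antitone fun k => ‖y k‖) {k : Fin K}
    {r : ℝ} (hk : ‖y k‖ < r) :
    ∃ T : Finset (Fin K), T.card = K - k ∧ ∀ j ∈ T, ‖x j‖ < r := by
  refine ⟨(Finset.Ici k).map σ.toEmbedding, by rw [Finset.card_map, Fin.card_Ici], ?_⟩
  intro j hj
  obtain ⟨i, hi, rfl⟩ := Finset.mem_map.1 hj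
  have h1 : ‖y i‖ ≤ ‖y k‖ := hy (Finset.mem_Ici.1 hi)
  rw [hσ i] at h1
  exact h1.trans_lt hk

section Probability

variable {Ω : Type*} [MeasurableSpace Ω] {μ : Measure Ω} {h : Fin K → Ω → Vec N}

theorem measure_preimage_ball (hlaw : ∀ k, HasLaw (h k) (rayleigh N) μ) (j : Fin K) (r : ℝ) :
    μ (h j ⁻¹' Metric.ball 0 r) = rayleigh N (Metric.ball 0 r) := by
  rw [← (hlaw j).map_eq, Measure.map_apply_of_aemeasurable (hlaw j).aemeasurable measurableSet_ball]

theorem measure_biInter_preimage_ball (hlaw : ∀ k, HasLaw (h k) (rayleigh N) μ)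
    (hindep : iIndepFun h μ) (T : Finset (Fin K)) (r : ℝ) :
    μ (⋂ j ∈ T, h j ⁻¹' Metric.ball 0 r) = rayleigh N (Metric.ball 0 r) ^ T.card := by
  rw [hindep.measure_inter_preimage_eq_mul T fun _ _ => measurableSet_ball]
  simp [measure_preimage_ball hlaw]

/-- A channel vector is almost surely nonzero; for `N = 0` there is only the zero vector. -/
theorem measure_exists_eq_zero (hN : 0 < N) (hlaw : ∀ k, HasLaw (h k) (rayleigh N) μ) :
    μ {ω | ∃ j, h j ω = 0} = 0 := by
  rw [Set.ofPred_exists, measure_iUnion_null_iff]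
  intro j
  have hle : ∀ r > 0, μ {ω | h j ω = 0} ≤ ENNReal.ofReal (2 * r) ^ (2 * N) := by
    intro r hr
    refine (measure_mono fun ω hω => ?_).trans
      ((measure_preimage_ball hlaw j r).le.trans (rayleigh_ball_le r))
    rw [Set.mem_preimage, show h j ω = 0 from hω]
    exact Metric.mem_ball_self hr
  have hlim : Tendsto (fun r : ℝ => ENNReal.ofReal (2 * r) ^ (2 * N)) (𝓝[>] 0) (𝓝 0) := by
    have h1 : Tendsto (fun r : ℝ => ENNReal.ofReal (2 * r)) (𝓝[>] 0) (𝓝 0) := by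
      have h2 : Continuous fun r : ℝ => ENNReal.ofReal (2 * r) :=
        ENNReal.continuous_ofReal.comp (continuous_const.mul continuous_id)
      simpa using (h2.tendsto 0).mono_left nhdsWithin_le_nhds
    simpa [hN.ne'] using ENNReal.Tendsto.pow (n := 2 * N) h1
  refine le_antisymm (ge_of_tendsto hlim ?_) bot_le
  filter_upwards [self_mem_nhdsWithin] with r hr using hle r hr

end Probability

/-! ### The diversity order -/

/-- Matching power bounds determine the exponent. -/
theorem tendsto_neg_log_div_log {f : ℝ → ℝ} {a b : ℝ} (ha : 0 < a) (hb : 0 < b) (D : ℕ)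
    (hf : ∀ᶠ x in atTop, a * (x ^ D)⁻¹ ≤ f x ∧ f x ≤ b * (x ^ D)⁻¹) :
    Tendsto (fun x => -(Real.log (f x) / Real.log x)) atTop (𝓝 D) := by
  have hlim : ∀ c : ℝ, Tendsto (fun x => (D : ℝ) - Real.log c / Real.log x) atTop (𝓝 D) := by
    intro c
    simpa using (tendsto_const_nhds (x := (D : ℝ))).sub
      ((tendsto_const_nhds (x := Real.log c)).div_atTop Real.tendsto_log_atTop)
  have hlog : ∀ c > 0, ∀ x : ℝ, 1 < x →
      (D : ℝ) - Real.log c / Real.log x = -(Real.log (c * (x ^ D)⁻¹) / Real.log x) := by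
    intro c hc x hx
    have hx0 : 0 < x := by linarith
    have hlx : 0 < Real.log x := Real.log_pos hx
    rw [Real.log_mul hc.ne' (by positivity), Real.log_inv, Real.log_pow]
    field_simp
    ring
  refine tendsto_of_tendsto_of_tendsto_of_le_of_le' (hlim b) (hlim a) ?_ ?_
  · filter_upwards [hf, eventually_gt_atTop 1] with x hx hx1
    have hlx : 0 < Real.log x := Real.log_pos hx1
    have hx0 : 0 < x := by linarith
    rw [hlog b hb x hx1, neg_le_neg_iff]
    exact div_le_div_of_nonneg_right
      (Real.log_le_log (lt_of_lt_of_le (by positivity) hx.1) hx.2) hlx.le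
  · filter_upwards [hf, eventually_gt_atTop 1] with x hx hx1
    have hlx : 0 < Real.log x := Real.log_pos hx1
    have hx0 : 0 < x := by linarith
    rw [hlog a ha x hx1, neg_le_neg_iff]
    exact div_le_div_of_nonneg_right (Real.log_le_log (by positivity) hx.1) hlx.le

end MisoBC

theorem theorem1 {Ω : Type*} [MeasurableSpace Ω] (μ : Measure Ω) [IsProbabilityMeasure μ]
    {N K : ℕ} (hKN : K ≤ N)
    -- independent Rayleigh fading channels of the `K` users
    (h : Fin K → Ω → MisoBC.Vec N)
    (hlaw : ∀ k, HasLaw (h k) (MisoBC.rayleigh N) μ)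
    (hindep : iIndepFun h μ)
    -- `H ω k` is the channel with the `(k + 1)`-st largest norm
    (H : Ω → Fin K → MisoBC.Vec N)
    (hH : ∀ ω, ∃ σ : Equiv.Perm (Fin K), ∀ k, H ω k = h (σ k) ω)
    (hord : ∀ ω, Antitone fun k => ‖H ω k‖)
    -- the groups returned by the grouping algorithm
    (θth : ℝ) (hθ : θth ∈ Set.Ioo (0 : ℝ) 1)
    (groups : Ω → List (Finset (Fin K)))
    (hgroups : ∀ ω, MisoBC.IsGrouping θth (H ω) (groups ω))
    -- the beam vectors of the groups
    (w : Ω → Finset (Fin K) → MisoBC.Vec N)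
    (hw : ∀ ω, ∀ G ∈ groups ω, MisoBC.IsMaxMinBeam (MisoBC.effChannel (H ω) G) G (w ω G))
    -- the target rate
    (Rth : ℝ) (hRth : 0 < Rth) :
    (∀ C : ℝ, 0 < C → MisoBC.IsProperSplit (K := K) Rth (MisoBC.explicitSplit Rth C)) ∧
    ∀ δ : Finset (Fin K) → ℕ → ℝ, MisoBC.IsProperSplit Rth δ →
      ∀ k : Fin K,
        Tendsto
          (fun Pt : ℝ =>
            -(Real.log (μ.real {ω | MisoBC.mixtureRate (H ω) (groups ω) δ (w ω) Pt k < Rth}) /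
              Real.log Pt))
          atTop (𝓝 ((N : ℝ) * ((K : ℝ) - ((k : ℝ) + 1) + 1))) := by
 
  refine ⟨fun C hC => MisoBC.isProperSplit_explicitSplit hRth hC, fun δ hδ k => ?_⟩
  have hN : 0 < N := (Fin.pos k).trans_le hKN
  have hT : (0 : ℝ) < 2 ^ Rth - 1 := sub_pos.2 (Real.one_lt_rpow (by norm_num) hRth)
  choose σ hσ using hH
  obtain ⟨A, hA, hrate⟩ := MisoBC.exists_le_mixtureRate (N := N) hθ hRth hδ
  obtain ⟨c, hc, hball⟩ := MisoBC.exists_le_rayleigh_ball N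
  have hD : (N : ℝ) * ((K : ℝ) - ((k : ℝ) + 1) + 1) = ((N * (K - k) : ℕ) : ℝ) := by
    rw [Nat.cast_mul, Nat.cast_sub k.isLt.le]
    ring
  rw [hD]
  -- The order of the probability that `K - k` independent channels, with `2 * N` real coordinates
  -- each, lie in a ball of radius `√(B / Pt)`.
  have hpow : ∀ a B Pt : ℝ, 0 ≤ B → 0 < Pt →
      ((a * √(B / Pt)) ^ (2 * N)) ^ (K - k : ℕ) =
        (a ^ 2 * B) ^ (N * (K - k)) * (Pt ^ (N * (K - k)))⁻¹ := by
    intro a B Pt hB hPt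
    rw [pow_mul, ← pow_mul, mul_pow a, Real.sq_sqrt (by positivity), ← inv_pow, ← mul_pow,
      div_eq_mul_inv, mul_assoc]
  refine MisoBC.tendsto_neg_log_div_log (a := (c ^ 2 * (2 ^ Rth - 1)) ^ (N * (K - k)))
    (b := 2 ^ K * (2 ^ 2 * A) ^ (N * (K - k))) (by positivity) (by positivity) _ ?_
  filter_upwards [eventually_gt_atTop 0, eventually_ge_atTop (2 ^ Rth - 1)] with Pt hPt hPt1
  set out : Set Ω := {ω | MisoBC.mixtureRate (H ω) (groups ω) δ (w ω) Pt k < Rth}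
  constructor
  · -- If the `K - k` users `j ≥ k` (in the original labelling) are weak, then so is the user of
    -- rank `k`.
    set r : ℝ := √((2 ^ Rth - 1) / Pt)
    have hr0 : 0 < r := Real.sqrt_pos.2 (by positivity)
    have hr1 : r ≤ 1 := Real.sqrt_le_one.2 ((div_le_one hPt).2 hPt1)
    have hsub : (⋂ j ∈ Finset.Ici k, h j ⁻¹' Metric.ball 0 r) ⊆ out := by
      intro ω hω
      have hk : ‖H ω k‖ < r := by
        refine MisoBC.norm_lt_of_card (x := fun j => h j ω) (hσ ω) (hord ω) (Fin.card_Ici k) ?_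
        intro j hj
        exact mem_ball_zero_iff.1 (Set.mem_iInter₂.1 hω j hj)
      exact MisoBC.mixtureRate_lt hδ (hgroups ω) (hw ω) hPt
        ((Real.lt_sqrt (norm_nonneg _)).1 hk)
    have hle := measure_mono (μ := μ) hsub
    rw [MisoBC.measure_biInter_preimage_ball hlaw hindep, Fin.card_Ici] at hle
    have hle2 := (pow_le_pow_left' (hball r hr0 hr1) (K - k)).trans hle
    rw [← ENNReal.ofReal_pow (by positivity), ← ENNReal.ofReal_pow (by positivity),
      hpow c _ Pt hT.le hPt] at hle2
    exact (ENNReal.ofReal_le_iff_le_toReal (measure_ne_top μ _)).1 hle2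
  · set r : ℝ := √(A / Pt)
    have hsub : out ⊆ {ω | ∃ j, h j ω = 0} ∪
        ⋃ T ∈ (Finset.univ : Finset (Fin K)).powersetCard (K - k),
          ⋂ j ∈ T, h j ⁻¹' Metric.ball 0 r := by
      intro ω hω
      by_cases h0 : ∃ j, h j ω = 0
      · exact Or.inl h0
      · right
        push Not at h0
        have hk : ‖H ω k‖ < r := by
          refine (Real.lt_sqrt (norm_nonneg _)).2 (not_le.1 fun hle => ?_)
          refine not_le.2 hω (hrate (H ω) (groups ω) (w ω) (hgroups ω) (hw ω) ?_ Pt hPt k hle)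
          intro u
          rw [hσ ω u]
          exact h0 _
        obtain ⟨T, hTcard, hTr⟩ :=
          MisoBC.exists_card_of_norm_lt (x := fun j => h j ω) (hσ ω) (hord ω) hk
        refine Set.mem_iUnion₂.2 ⟨T, by simp [Finset.mem_powersetCard, hTcard], ?_⟩
        exact Set.mem_iInter₂.2 fun j hj => mem_ball_zero_iff.2 (hTr j hj)
    have hle : μ out ≤ ENNReal.ofReal
        (2 ^ K * (2 ^ 2 * A) ^ (N * (K - k)) * (Pt ^ (N * (K - k)))⁻¹) := by
      calc μ out ≤ μ {ω | ∃ j, h j ω = 0} +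
            μ (⋃ T ∈ (Finset.univ : Finset (Fin K)).powersetCard (K - k),
              ⋂ j ∈ T, h j ⁻¹' Metric.ball 0 r) :=
            (measure_mono hsub).trans (measure_union_le _ _)
        _ ≤ 0 + ∑ T ∈ (Finset.univ : Finset (Fin K)).powersetCard (K - k),
              μ (⋂ j ∈ T, h j ⁻¹' Metric.ball 0 r) :=
            add_le_add (MisoBC.measure_exists_eq_zero hN hlaw).le (measure_biUnion_finset_le _ _)
        _ ≤ ∑ _T ∈ (Finset.univ : Finset (Fin K)).powersetCard (K - k),
              ENNReal.ofReal (((2 * r) ^ (2 * N)) ^ (K - k : ℕ)) := by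
            rw [zero_add]
            refine Finset.sum_le_sum fun T hT => ?_
            rw [MisoBC.measure_biInter_preimage_ball hlaw hindep,
              (Finset.mem_powersetCard.1 hT).2, ENNReal.ofReal_pow (by positivity),
              ENNReal.ofReal_pow (by positivity)]
            exact pow_le_pow_left' (MisoBC.rayleigh_ball_le r) _
        _ ≤ 2 ^ K * ENNReal.ofReal (((2 * r) ^ (2 * N)) ^ (K - k : ℕ)) := by
            rw [Finset.sum_const, Finset.card_powersetCard, Finset.card_univ, Fintype.card_fin,
              nsmul_eq_mul]
            exact mul_le_mul_left (by exact_mod_cast Nat.choose_le_two_pow K (K - k)) _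
        _ = _ := by
            rw [hpow 2 A Pt hA.le hPt, mul_assoc, ENNReal.ofReal_mul (p := 2 ^ K) (by positivity),
              ENNReal.ofReal_pow (by norm_num), ENNReal.ofReal_ofNat]
    exact ENNReal.toReal_le_of_le_ofReal (by positivity) hle
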